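/- Fix $d, m \ge 0$. A polyhedral $m$-chain in $[0,1]^d$ is a finite real linear combination of oriented nondegenerate $m$-simplices contained in $[0,1]^d$, where reversing the orientation of a simplex changes its sign and a simplex that is cut into two simplices equals the sum of the two pieces with the inherited orientation. (Every oriented convex polytope is such a chain.) Its mass is $\mathbf M(T) = \min \sum_i |a_i| \mathscr H^m(\sigma_i)$ over the representations $T = \sum_i a_i \sigma_i$; the minimum is attained by the representations with non-overlapping $\sigma_i$. Let $\partial$ be the boundary operator (with $\partial = 0$ on $0$-chains), and let the flat norm be $$\mathbf F(T) = \inf\{\mathbf M(R) + \mathbf M(S) : T = R + \partial S\},$$ where $R$ and $S$ are polyhedral chains of dimensions $m$ and $m+1$. The space $\mathbf F_m$ of flat $m$-chains is the completion of the polyhedral $m$-chains for $\mathbf F$, to which $\partial$ extends continuously. The space $\mathbf F^m$ of flat $m$-cochains is the dual of $\mathbf F_m$, with the dual norm $\|\cdot\|_{\mathbf F^m}$. For $T \in \mathbf F_m$, let $\mathbf M(T) \in [0,\infty]$ be the infimum of $\liminf_n \mathbf M(T_n)$ over the sequences $(T_n)$ of polyhedral chains that converge to $T$ in flat norm. Put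 $\mathbf N(T) = \mathbf M(T) + \mathbf M(\partial T)$, and let $\mathbf N_m = \{T \in \mathbf F_m : \mathbf N(T) < \infty\}$ be the space of normal $m$-currents. An $m$-charge is a linear functional $\omega$ on $\mathbf N_m$ such that $\omega(T_n) \to 0$ whenever $\mathbf F(T_n) \to 0$ and $\sup_n \mathbf N(T_n) < \infty$; the space $\mathbf{CH}^m$ of $m$-charges carries the norm $\|\omega\|_{\mathbf{CH}^m} = \sup\{\omega(T) : \mathbf N(T) \le 1\}$. Flat $m$-cochains are regarded as $m$-charges by restriction to $\mathbf N_m$. For $0 < \gamma < 1$, a $\gamma$-fractional $m$-charge is a linear functional $\omega$ on $\mathbf N_m$ for which there is a constant $C \ge 0$ with $|\omega(T)| \le C\, \mathbf N(T)^{1-\gamma} \mathbf F(T)^{\gamma}$ for all $T \in \mathbf N_m$; the best such constant is $\|\omega\|_{\mathbf{CH}^{m,\gamma}}$. A sequence of $\gamma$-fractional $m$-charges converges weakly* to a $\gamma$-fractional $m$-charge $\omega$ if it is bounded in $\|\cdot\|_{\mathbf{CH}^{m,\gamma}}$ and converges to $\omega$ in $\mathbf{CH}^m$. **Lemma.** Let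 $0 < \gamma < 1$. There is a constant $C = C(\gamma)$, independent of $d$ and $m$, with the following property. Let $\kappa \ge 0$ and let $(\omega_n)_{n \ge 0}$ be a sequence of flat $m$-cochains on $[0,1]^d$ such that, for all $n \ge 0$, $$\|\omega_n\|_{\mathbf F^m} \le \kappa\, 2^{n(1-\gamma)} \quad\text{and}\quad \|\omega_n\|_{\mathbf{CH}^m} \le \frac{\kappa}{2^{n\gamma}}.$$ Then the series $\sum_{n=0}^\infty \omega_n$ (that is, the sequence of its partial sums) converges weakly* to a $\gamma$-fractional $m$-charge, and $$\Bigl\| \sum_{n=0}^\infty \omega_n \Bigr\|_{\mathbf{CH}^{m,\gamma}} \le C \kappa.$$ -/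

import Mathlib

open MeasureTheory Filter Topology
open scoped ENNReal NNReal

noncomputable section

namespace FlatChains

/-- The unit cube `[0, 1]^d` in Euclidean space. -/
def unitCube (d : ℕ) : Set (EuclideanSpace ℝ (Fin d)) :=
  {x | ∀ i, x i ∈ Set.Icc (0 : ℝ) 1}

/-- A nondegenerate `m`-simplex in `[0, 1]^d` with ordered vertices. The order of the vertices
encodes the orientation. -/
structure CubeSimplex (d m : ℕ) extends Affine.Simplex ℝ (EuclideanSpace ℝ (Fin d)) m where
  points_mem : ∀ i, points i ∈ unitCube d

variable {d m : ℕ}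

theorem CubeSimplex.ext_points {s t : CubeSimplex d m} (h : ∀ i, s.points i = t.points i) :
    s = t := by
  obtain ⟨s, hs⟩ := s
  obtain ⟨t, ht⟩ := t
  have : s = t := Affine.Simplex.ext h
  subst this
  rfl

/-- The underlying set of the simplex, i.e. the convex hull of its vertices. -/
def CubeSimplex.carrier (s : CubeSimplex d m) : Set (EuclideanSpace ℝ (Fin d)) :=
  convexHull ℝ (Set.range s.points)

/-- The `m`-dimensional volume `ℋ^m(s)`, for the Hausdorff measure normalized so that it coincides
with the Lebesgue measure on `m`-dimensional Euclidean spaces. -/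
def CubeSimplex.vol (s : CubeSimplex d m) : ℝ :=
  (Measure.euclideanHausdorffMeasure m : Measure (EuclideanSpace ℝ (Fin d))).real s.carrier

theorem CubeSimplex.vol_nonneg (s : CubeSimplex d m) : 0 ≤ s.vol := measureReal_nonneg

/-- Relabelling of the vertices. -/
def CubeSimplex.reindex (s : CubeSimplex d m) (e : Equiv.Perm (Fin (m + 1))) : CubeSimplex d m where
  toSimplex := s.toSimplex.reindex e
  points_mem i := s.points_mem (e.symm i)

/-- The face opposite to the `i`-th vertex. -/
def CubeSimplex.face (s : CubeSimplex d (m + 1)) (i : Fin (m + 2)) : CubeSimplex d m where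
  toSimplex := s.toSimplex.faceOpposite i
  points_mem j := by
    have := s.toSimplex.faceOpposite_point_eq_point_succAbove i j
    rw [this]
    exact s.points_mem _

theorem CubeSimplex.face_points (s : CubeSimplex d (m + 1)) (i : Fin (m + 2)) (j : Fin (m + 1)) :
    (s.face i).points j = s.points (i.succAbove j) :=
  s.toSimplex.faceOpposite_point_eq_point_succAbove i j

theorem CubeSimplex.reindex_points (s : CubeSimplex d m) (e : Equiv.Perm (Fin (m + 1)))
    (i : Fin (m + 1)) : (s.reindex e).points i = s.points (e.symm i) := rfl

/-- The simplex `s` is bisected into `s₁` and `s₂` by a point `q` of the open edge joining its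
vertices `i` and `j`: `s₁` is obtained by moving the `i`-th vertex to `q`, and `s₂` by moving the
`j`-th vertex to `q`. -/
def CubeSimplex.IsBisection (s s₁ s₂ : CubeSimplex d m) (i j : Fin (m + 1)) : Prop :=
  i ≠ j ∧ ∃ q ∈ openSegment ℝ (s.points i) (s.points j),
    s₁.points = Function.update s.points i q ∧ s₂.points = Function.update s.points j q

/-- Formal real linear combinations of oriented `m`-simplices of `[0, 1]^d`. -/
abbrev FormalChain (d m : ℕ) : Type := CubeSimplex d m →₀ ℝ

/-- The identifications between formal chains: a relabelling of the vertices multiplies an oriented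
simplex by the sign of the permutation, and a simplex that is cut in two is the sum of the two
pieces. -/
inductive ElementaryRelation : FormalChain d m → Prop
  | reindex (s : CubeSimplex d m) (e : Equiv.Perm (Fin (m + 1))) :
      ElementaryRelation (Finsupp.single (s.reindex e) 1 -
        Finsupp.single s (((Equiv.Perm.sign e : ℤˣ) : ℤ) : ℝ))
  | glue (s s₁ s₂ : CubeSimplex d m) (i j : Fin (m + 1)) (h : s.IsBisection s₁ s₂ i j) :
      ElementaryRelation (Finsupp.single s 1 - (Finsupp.single s₁ 1 + Finsupp.single s₂ 1))

/-- The subspace generated by the identifications. -/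
def relations (d m : ℕ) : Submodule ℝ (FormalChain d m) :=
  Submodule.span ℝ {c | ElementaryRelation c}

/-- The boundary of formal chains, `∂ [p₀, …, pₘ₊₁] = ∑ i, (-1)^i [p₀, …, p̂ᵢ, …, pₘ₊₁]`. -/
def formalBoundary (d m : ℕ) : FormalChain d (m + 1) →ₗ[ℝ] FormalChain d m :=
  Finsupp.linearCombination ℝ
    fun s => ∑ i : Fin (m + 2), Finsupp.single (s.face i) ((-1 : ℝ) ^ (i : ℕ))

theorem formalBoundary_single (s : CubeSimplex d (m + 1)) (a : ℝ) :
    formalBoundary d m (Finsupp.single s a) =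
      a • ∑ i : Fin (m + 2), Finsupp.single (s.face i) ((-1 : ℝ) ^ (i : ℕ)) := by
  simp [formalBoundary, Finsupp.linearCombination_single]

theorem formalBoundary_formalBoundary (c : FormalChain d (m + 2)) :
    formalBoundary d m (formalBoundary d (m + 1) c) = 0 := by
  induction c using Finsupp.induction_linear with
  | zero => simp
  | add f g hf hg => simp [hf, hg]
  | single s a =>
    have h1 : formalBoundary d m (formalBoundary d (m + 1) (Finsupp.single s a)) =
        a • ∑ p : Fin (m + 3) × Fin (m + 2), Finsupp.single ((s.face p.1).face p.2)
          ((-1 : ℝ) ^ ((p.1 : ℕ) + (p.2 : ℕ))) := by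
      rw [formalBoundary_single, map_smul, map_sum, Fintype.sum_prod_type]
      congr 1
      refine Finset.sum_congr rfl fun i _ => ?_
      rw [formalBoundary_single, Finset.smul_sum]
      refine Finset.sum_congr rfl fun j _ => ?_
      rw [Finsupp.smul_single, smul_eq_mul, pow_add]
    rw [h1]
    rw [Finset.sum_involution (fun p _ => (p.1.succAbove p.2, p.2.predAbove p.1)), smul_zero]
    · rintro ⟨i, j⟩ -
      have hface : (s.face (i.succAbove j)).face (j.predAbove i) = (s.face i).face j := by
        apply CubeSimplex.ext_points
        intro k
        simp only [CubeSimplex.face_points]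
        rw [Fin.succAbove_succAbove_succAbove_predAbove]
      simp only [hface, ← Finsupp.single_add]
      rw [Fin.neg_one_pow_succAbove_add_predAbove]
      simp
    · rintro ⟨i, j⟩ - - h
      exact Fin.succAbove_ne i j (congrArg Prod.fst h)
    · simp
    · rintro ⟨i, j⟩ -
      simp [Fin.succAbove_succAbove_predAbove, Fin.predAbove_predAbove_succAbove]

theorem mk_reindex (s : CubeSimplex d m) (e : Equiv.Perm (Fin (m + 1))) :
    (relations d m).mkQ (Finsupp.single (s.reindex e) 1) =
      (((Equiv.Perm.sign e : ℤˣ) : ℤ) : ℝ) • (relations d m).mkQ (Finsupp.single s 1) := by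
  rw [← sub_eq_zero, ← map_smul, ← map_sub, Finsupp.smul_single, smul_eq_mul, mul_one]
  simp only [Submodule.mkQ_apply, Submodule.Quotient.mk_eq_zero]
  exact Submodule.subset_span (ElementaryRelation.reindex s e)

theorem mk_glue {s s₁ s₂ : CubeSimplex d m} {i j : Fin (m + 1)} (h : s.IsBisection s₁ s₂ i j) :
    (relations d m).mkQ (Finsupp.single s 1) =
      (relations d m).mkQ (Finsupp.single s₁ 1) + (relations d m).mkQ (Finsupp.single s₂ 1) := by
  rw [← sub_eq_zero, ← map_add, ← map_sub]
  simp only [Submodule.mkQ_apply, Submodule.Quotient.mk_eq_zero]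
  exact Submodule.subset_span (ElementaryRelation.glue s s₁ s₂ i j h)

/-- The class of the boundary of a single simplex. -/
theorem mk_formalBoundary_single (s : CubeSimplex d (m + 1)) :
    (relations d m).mkQ (formalBoundary d m (Finsupp.single s 1)) =
      ∑ i : Fin (m + 2), ((-1 : ℝ) ^ (i : ℕ)) • (relations d m).mkQ (Finsupp.single (s.face i) 1) := by
  rw [formalBoundary_single, one_smul, map_sum]
  refine Finset.sum_congr rfl fun i _ => ?_
  rw [← map_smul, Finsupp.smul_single, smul_eq_mul, mul_one]

theorem swap_succAbove_succ {n : ℕ} (a j : Fin n) :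
    Equiv.swap a.castSucc a.succ (a.succ.succAbove j) = a.castSucc.succAbove j := by
  simp only [Equiv.swap_apply_def, Fin.succAbove, Fin.lt_def, Fin.ext_iff, Fin.val_castSucc,
    Fin.val_succ]
  split_ifs <;> simp_all <;> omega

theorem mk_formalBoundary_reindex_swap (s : CubeSimplex d (m + 1)) (a : Fin (m + 1)) :
    (relations d m).mkQ (formalBoundary d m
        (Finsupp.single (s.reindex (Equiv.swap a.castSucc a.succ)) 1)) =
      - (relations d m).mkQ (formalBoundary d m (Finsupp.single s 1)) := by
  rw [mk_formalBoundary_single, mk_formalBoundary_single, ← Finset.sum_neg_distrib]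
  rw [← Equiv.sum_comp (Equiv.swap a.castSucc a.succ)]
  refine Finset.sum_congr rfl fun k _ => ?_
  by_cases hk : k = a.castSucc
  · subst hk
    rw [Equiv.swap_apply_left]
    have : (s.reindex (Equiv.swap a.castSucc a.succ)).face a.succ = s.face a.castSucc := by
      apply CubeSimplex.ext_points
      intro j
      rw [CubeSimplex.face_points, CubeSimplex.face_points, CubeSimplex.reindex_points,
        Equiv.symm_swap]
      congr 1
      exact swap_succAbove_succ a j
    rw [this]
    simp [pow_succ]
  by_cases hk' : k = a.succ
  · subst hk'
    rw [Equiv.swap_apply_right]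
    have : (s.reindex (Equiv.swap a.castSucc a.succ)).face a.castSucc = s.face a.succ := by
      apply CubeSimplex.ext_points
      intro j
      rw [CubeSimplex.face_points, CubeSimplex.face_points, CubeSimplex.reindex_points,
        Equiv.symm_swap]
      congr 1
      rw [← swap_succAbove_succ a j, Equiv.swap_apply_self]
    rw [this]
    simp [pow_succ]
  rw [Equiv.swap_apply_of_ne_of_ne hk hk']
  obtain ⟨i', hi'⟩ := Fin.exists_succAbove_eq (Ne.symm hk)
  obtain ⟨j', hj'⟩ := Fin.exists_succAbove_eq (Ne.symm hk')
  have hij : i' ≠ j' := by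
    rintro rfl
    rw [hi'] at hj'
    simp [Fin.ext_iff] at hj'
  have : (s.reindex (Equiv.swap a.castSucc a.succ)).face k =
      (s.face k).reindex (Equiv.swap i' j') := by
    apply CubeSimplex.ext_points
    intro l
    rw [CubeSimplex.face_points, CubeSimplex.reindex_points, CubeSimplex.reindex_points,
      CubeSimplex.face_points, Equiv.symm_swap, Equiv.symm_swap, ← hi', ← hj',
      (Fin.succAbove_right_injective (p := k)).map_swap]
  rw [this, mk_reindex, Equiv.Perm.sign_swap hij]
  simp

theorem mk_formalBoundary_reindex (s : CubeSimplex d (m + 1)) (e : Equiv.Perm (Fin (m + 2))) :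
    (relations d m).mkQ (formalBoundary d m (Finsupp.single (s.reindex e) 1)) =
      (((Equiv.Perm.sign e : ℤˣ) : ℤ) : ℝ) •
        (relations d m).mkQ (formalBoundary d m (Finsupp.single s 1)) := by
  have key : ∀ e ∈ Submonoid.closure
      (Set.range fun i : Fin (m + 1) => Equiv.swap i.castSucc i.succ),
      ∀ s : CubeSimplex d (m + 1),
      (relations d m).mkQ (formalBoundary d m (Finsupp.single (s.reindex e) 1)) =
      (((Equiv.Perm.sign e : ℤˣ) : ℤ) : ℝ) •
        (relations d m).mkQ (formalBoundary d m (Finsupp.single s 1)) := by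
    intro e he
    induction he using Submonoid.closure_induction with
    | mem x hx =>
      obtain ⟨a, rfl⟩ := hx
      intro s
      simp only
      rw [mk_formalBoundary_reindex_swap, Equiv.Perm.sign_swap (by simp [Fin.ext_iff])]
      simp
    | one =>
      intro s
      have : s.reindex 1 = s := CubeSimplex.ext_points fun _ => rfl
      simp [this]
    | mul x y _ _ hx hy =>
      intro s
      have : s.reindex (x * y) = (s.reindex y).reindex x := CubeSimplex.ext_points fun _ => rfl
      rw [this, hx, hy, smul_smul]
      simp
  exact key e (by rw [Equiv.Perm.mclosure_swap_castSucc_succ]; trivial) s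

/-- Faces of the pieces of a bisection, away from the divided edge. -/
theorem CubeSimplex.IsBisection.face {s s₁ s₂ : CubeSimplex d (m + 1)} {i j : Fin (m + 2)}
    (h : s.IsBisection s₁ s₂ i j) {k : Fin (m + 2)} {i' j' : Fin (m + 1)}
    (hi : k.succAbove i' = i) (hj : k.succAbove j' = j) :
    (s.face k).IsBisection (s₁.face k) (s₂.face k) i' j' := by
  obtain ⟨hij, q, hq, h₁, h₂⟩ := h
  subst hi hj
  refine ⟨fun h => hij (by rw [h]), q, by simpa only [CubeSimplex.face_points] using hq, ?_, ?_⟩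
  · funext l
    rw [CubeSimplex.face_points, h₁]
    by_cases hl : l = i'
    · subst hl; simp
    · rw [Function.update_of_ne hl, Function.update_of_ne
        (fun h => hl (Fin.succAbove_right_injective h)), CubeSimplex.face_points]
  · funext l
    rw [CubeSimplex.face_points, h₂]
    by_cases hl : l = j'
    · subst hl; simp
    · rw [Function.update_of_ne hl, Function.update_of_ne
        (fun h => hl (Fin.succAbove_right_injective h)), CubeSimplex.face_points]

theorem mk_formalBoundary_glue_zero_one {s s₁ s₂ : CubeSimplex d (m + 1)}
    (h : s.IsBisection s₁ s₂ 0 1) :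
    (relations d m).mkQ (formalBoundary d m (Finsupp.single s 1)) =
      (relations d m).mkQ (formalBoundary d m (Finsupp.single s₁ 1)) +
        (relations d m).mkQ (formalBoundary d m (Finsupp.single s₂ 1)) := by
  have h' := h
  obtain ⟨-, q, hq, h₁, h₂⟩ := h'
  have e0 : s₁.face 0 = s.face 0 := by
    apply CubeSimplex.ext_points
    intro l
    rw [CubeSimplex.face_points, CubeSimplex.face_points, h₁,
      Function.update_of_ne (Fin.succAbove_ne _ _)]
  have e1 : s₂.face 1 = s.face 1 := by
    apply CubeSimplex.ext_points
    intro l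
    rw [CubeSimplex.face_points, CubeSimplex.face_points, h₂,
      Function.update_of_ne (Fin.succAbove_ne _ _)]
  have e2 : s₂.face 0 = s₁.face 1 := by
    apply CubeSimplex.ext_points
    intro l
    rw [CubeSimplex.face_points, CubeSimplex.face_points, h₁, h₂]
    refine Fin.cases ?_ (fun l => ?_) l
    · simp
    · have : (1 : Fin (m + 2)).succAbove l.succ = l.succ.succ := by
        rw [Fin.succAbove_of_le_castSucc]
        simp [Fin.le_def]
      rw [this, Fin.zero_succAbove, Function.update_of_ne (by simp [Fin.ext_iff]),
        Function.update_of_ne (by simp [Fin.ext_iff])]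
  simp only [mk_formalBoundary_single]
  rw [← Finset.sum_add_distrib, Fin.sum_univ_succ, Fin.sum_univ_succ, Fin.sum_univ_succ,
    Fin.sum_univ_succ]
  have rest : ∀ l : Fin m, (relations d m).mkQ (Finsupp.single (s.face l.succ.succ) 1) =
      (relations d m).mkQ (Finsupp.single (s₁.face l.succ.succ) 1) +
      (relations d m).mkQ (Finsupp.single (s₂.face l.succ.succ) 1) := by
    intro l
    obtain ⟨i', hi'⟩ := Fin.exists_succAbove_eq (x := (0 : Fin (m + 2))) (y := l.succ.succ)
      (by simp [Fin.ext_iff])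
    obtain ⟨j', hj'⟩ := Fin.exists_succAbove_eq (x := (1 : Fin (m + 2))) (y := l.succ.succ)
      (by simp [Fin.ext_iff])
    exact mk_glue (h.face hi' hj')
  rw [Fin.succ_zero_eq_one, e0, e1, e2]
  simp_rw [rest, smul_add, Finset.sum_add_distrib]
  simp
  abel

theorem mk_formalBoundary_glue {s s₁ s₂ : CubeSimplex d (m + 1)} {i j : Fin (m + 2)}
    (h : s.IsBisection s₁ s₂ i j) :
    (relations d m).mkQ (formalBoundary d m (Finsupp.single s 1)) =
      (relations d m).mkQ (formalBoundary d m (Finsupp.single s₁ 1)) +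
        (relations d m).mkQ (formalBoundary d m (Finsupp.single s₂ 1)) := by
  obtain ⟨e, rfl, rfl⟩ : ∃ e : Equiv.Perm (Fin (m + 2)), e.symm 0 = i ∧ e.symm 1 = j := by
    let f : Equiv.Perm (Fin (m + 2)) := Equiv.swap 0 i
    let g : Equiv.Perm (Fin (m + 2)) := Equiv.swap (f 1) j
    refine ⟨(g * f).symm, ?_, ?_⟩
    · have h1 : f 1 ≠ i := by
        intro hc
        have : f 1 = f 0 := by rw [hc]; simp [f]
        simpa using f.injective this
      simp only [Equiv.symm_symm, Equiv.Perm.mul_apply]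
      have : f 0 = i := by simp [f]
      rw [this]
      exact Equiv.swap_apply_of_ne_of_ne h1.symm h.1
    · simp [g]
  have hb : (s.reindex e).IsBisection (s₁.reindex e) (s₂.reindex e) 0 1 := by
    obtain ⟨hij, q, hq, h₁, h₂⟩ := h
    refine ⟨by simp, q, hq, ?_, ?_⟩
    · funext l
      rw [CubeSimplex.reindex_points, h₁]
      simp only [Function.update_apply, EmbeddingLike.apply_eq_iff_eq, CubeSimplex.reindex_points]
    · funext l
      rw [CubeSimplex.reindex_points, h₂]
      simp only [Function.update_apply, EmbeddingLike.apply_eq_iff_eq, CubeSimplex.reindex_points]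
  have := mk_formalBoundary_glue_zero_one hb
  simp only [mk_formalBoundary_reindex] at this
  rw [← smul_add] at this
  refine smul_right_injective _ ?_ this
  simp

theorem relations_le_comap (d m : ℕ) :
    relations d (m + 1) ≤ (relations d m).comap (formalBoundary d m) := by
  refine Submodule.span_le.2 ?_
  rintro c hc
  have : (relations d m).mkQ (formalBoundary d m c) = 0 := by
    cases hc with
    | reindex s e =>
      have : Finsupp.single s (((Equiv.Perm.sign e : ℤˣ) : ℤ) : ℝ) =
          (((Equiv.Perm.sign e : ℤˣ) : ℤ) : ℝ) • Finsupp.single s (1 : ℝ) := by simp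
      rw [this, map_sub, map_smul, map_sub, map_smul, mk_formalBoundary_reindex, sub_self]
    | glue s s₁ s₂ i j h =>
      rw [map_sub, map_add, map_sub, map_add, mk_formalBoundary_glue h, sub_self]
  simpa using this

/-- The space `𝐏ₘ([0, 1]^d)` of polyhedral `m`-chains. -/
def PolyChain (d m : ℕ) : Type := FormalChain d m ⧸ relations d m

instance : AddCommGroup (PolyChain d m) :=
  inferInstanceAs (AddCommGroup (FormalChain d m ⧸ relations d m))

instance : Module ℝ (PolyChain d m) :=
  inferInstanceAs (Module ℝ (FormalChain d m ⧸ relations d m))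

/-- The polyhedral chain represented by a formal combination of oriented simplices. -/
def toPoly (d m : ℕ) : FormalChain d m →ₗ[ℝ] PolyChain d m := (relations d m).mkQ

theorem toPoly_surjective : Function.Surjective (toPoly d m) :=
  (relations d m).mkQ_surjective

/-- The boundary operator on polyhedral chains. -/
def polyBoundary (d m : ℕ) : PolyChain d (m + 1) →ₗ[ℝ] PolyChain d m :=
  (relations d (m + 1)).mapQ (relations d m) (formalBoundary d m) (relations_le_comap d m)

theorem polyBoundary_toPoly (c : FormalChain d (m + 1)) :
    polyBoundary d m (toPoly d (m + 1) c) = toPoly d m (formalBoundary d m c) :=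
  (relations d (m + 1)).mapQ_apply _ _ c

theorem polyBoundary_polyBoundary (T : PolyChain d (m + 2)) :
    polyBoundary d m (polyBoundary d (m + 1) T) = 0 := by
  obtain ⟨c, rfl⟩ := toPoly_surjective T
  rw [polyBoundary_toPoly, polyBoundary_toPoly, formalBoundary_formalBoundary, map_zero]

/-- The quantity `∑ |aᵢ| ℋ^m(σᵢ)` of a formal chain `∑ aᵢ σᵢ`. -/
def formalMass (c : FormalChain d m) : ℝ := c.sum fun s a => |a| * s.vol

theorem formalMass_nonneg (c : FormalChain d m) : 0 ≤ formalMass c :=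
  Finset.sum_nonneg fun s _ => mul_nonneg (abs_nonneg _) s.vol_nonneg

theorem formalMass_zero : formalMass (0 : FormalChain d m) = 0 := Finsupp.sum_zero_index

theorem formalMass_smul (a : ℝ) (c : FormalChain d m) :
    formalMass (a • c) = |a| * formalMass c := by
  rw [formalMass, Finsupp.sum_smul_index (by simp), formalMass, Finsupp.mul_sum]
  simp only [abs_mul, mul_assoc]

theorem formalMass_add_le (c c' : FormalChain d m) :
    formalMass (c + c') ≤ formalMass c + formalMass c' := by
  classical
  have h : ∀ x : FormalChain d m, x.support ⊆ c.support ∪ c'.support →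
      formalMass x = ∑ s ∈ c.support ∪ c'.support, |x s| * s.vol := fun x hx =>
    Finsupp.sum_of_support_subset _ hx _ (by simp)
  rw [h _ Finsupp.support_add, h _ Finset.subset_union_left, h _ Finset.subset_union_right,
    ← Finset.sum_add_distrib]
  refine Finset.sum_le_sum fun s _ => ?_
  rw [← add_mul]
  exact mul_le_mul_of_nonneg_right (abs_add_le _ _) s.vol_nonneg

/-- The mass of a polyhedral chain: the least value of `∑ |aᵢ| ℋ^m(σᵢ)` among the representations
`∑ aᵢ σᵢ` of the chain. The least value is attained when distinct `σᵢ` only meet in common faces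
of dimension `< m`. -/
def polyMass (T : PolyChain d m) : ℝ :=
  ⨅ c : {c : FormalChain d m // toPoly d m c = T}, formalMass c.1

theorem polyMass_nonneg (T : PolyChain d m) : 0 ≤ polyMass T :=
  Real.iInf_nonneg fun c => formalMass_nonneg c.1

theorem polyMass_le (c : FormalChain d m) : polyMass (toPoly d m c) ≤ formalMass c :=
  ciInf_le (f := fun c' : {c' : FormalChain d m // toPoly d m c' = toPoly d m c} =>
    formalMass c'.1) ⟨0, by rintro _ ⟨c, rfl⟩; exact formalMass_nonneg c.1⟩ ⟨c, rfl⟩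

theorem exists_formalMass_lt {T : PolyChain d m} {r : ℝ} (h : polyMass T < r) :
    ∃ c, toPoly d m c = T ∧ formalMass c < r := by
  have : Nonempty {c : FormalChain d m // toPoly d m c = T} :=
    let ⟨c, hc⟩ := toPoly_surjective T; ⟨⟨c, hc⟩⟩
  obtain ⟨c, hc⟩ := exists_lt_of_ciInf_lt h
  exact ⟨c.1, c.2, hc⟩

theorem polyMass_zero : polyMass (0 : PolyChain d m) = 0 := by
  refine le_antisymm ?_ (polyMass_nonneg _)
  have := polyMass_le (0 : FormalChain d m)
  rwa [map_zero, formalMass_zero] at this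

theorem polyMass_add_le (T T' : PolyChain d m) :
    polyMass (T + T') ≤ polyMass T + polyMass T' := by
  refine le_of_forall_pos_lt_add fun ε hε => ?_
  obtain ⟨c, rfl, hc⟩ := exists_formalMass_lt (show polyMass T < polyMass T + ε / 2 by linarith)
  obtain ⟨c', rfl, hc'⟩ :=
    exists_formalMass_lt (show polyMass T' < polyMass T' + ε / 2 by linarith)
  have h1 := polyMass_le (c + c')
  rw [map_add] at h1
  linarith [formalMass_add_le c c']

theorem polyMass_smul_le (a : ℝ) (T : PolyChain d m) : polyMass (a • T) ≤ |a| * polyMass T := by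
  refine le_of_forall_pos_lt_add fun ε hε => ?_
  have hpos : 0 < |a| + 1 := by positivity
  obtain ⟨c, rfl, hc⟩ := exists_formalMass_lt
    (show polyMass T < polyMass T + ε / (|a| + 1) by linarith [div_pos hε hpos])
  have h1 := polyMass_le (a • c)
  rw [map_smul, formalMass_smul] at h1
  have h2 : |a| * (ε / (|a| + 1)) < ε := by
    rw [mul_div_assoc', div_lt_iff₀ hpos]; nlinarith
  nlinarith [abs_nonneg a]

/-- The flat norm of a polyhedral chain,
`𝐅(T) = inf {𝐌(R) + 𝐌(S) : T = R + ∂S}`. -/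
def polyFlat (T : PolyChain d m) : ℝ :=
  ⨅ p : {p : PolyChain d m × PolyChain d (m + 1) // T = p.1 + polyBoundary d m p.2},
    (polyMass p.1.1 + polyMass p.1.2)

theorem polyFlat_nonneg (T : PolyChain d m) : 0 ≤ polyFlat T :=
  Real.iInf_nonneg fun _ => add_nonneg (polyMass_nonneg _) (polyMass_nonneg _)

theorem polyFlat_le (R : PolyChain d m) (S : PolyChain d (m + 1)) :
    polyFlat (R + polyBoundary d m S) ≤ polyMass R + polyMass S :=
  ciInf_le (f := fun p : {p : PolyChain d m × PolyChain d (m + 1) //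
      R + polyBoundary d m S = p.1 + polyBoundary d m p.2} => polyMass p.1.1 + polyMass p.1.2)
    ⟨0, by rintro _ ⟨c, rfl⟩; exact add_nonneg (polyMass_nonneg _) (polyMass_nonneg _)⟩
    ⟨(R, S), rfl⟩

theorem exists_of_polyFlat_lt {T : PolyChain d m} {r : ℝ} (h : polyFlat T < r) :
    ∃ R S, T = R + polyBoundary d m S ∧ polyMass R + polyMass S < r := by
  have : Nonempty {p : PolyChain d m × PolyChain d (m + 1) // T = p.1 + polyBoundary d m p.2} :=
    ⟨⟨(T, 0), by simp⟩⟩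
  obtain ⟨p, hp⟩ := exists_lt_of_ciInf_lt h
  exact ⟨p.1.1, p.1.2, p.2, hp⟩

theorem polyFlat_le_polyMass (T : PolyChain d m) : polyFlat T ≤ polyMass T := by
  simpa [polyMass_zero] using polyFlat_le T 0

theorem polyFlat_boundary_le (T : PolyChain d (m + 1)) :
    polyFlat (polyBoundary d m T) ≤ polyFlat T := by
  refine le_of_forall_pos_lt_add fun ε hε => ?_
  obtain ⟨R, S, rfl, h⟩ := exists_of_polyFlat_lt (show polyFlat T < polyFlat T + ε by linarith)
  have := polyFlat_le 0 R
  rw [polyMass_zero, zero_add, zero_add] at this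
  rw [map_add, polyBoundary_polyBoundary, add_zero]
  linarith [polyMass_nonneg S]

theorem polyFlat_zero : polyFlat (0 : PolyChain d m) = 0 :=
  le_antisymm ((polyFlat_le_polyMass 0).trans_eq polyMass_zero) (polyFlat_nonneg _)

theorem polyFlat_add_le (T T' : PolyChain d m) :
    polyFlat (T + T') ≤ polyFlat T + polyFlat T' := by
  refine le_of_forall_pos_lt_add fun ε hε => ?_
  obtain ⟨R, S, h, hlt⟩ :=
    exists_of_polyFlat_lt (show polyFlat T < polyFlat T + ε / 2 by linarith)
  obtain ⟨R', S', h', hlt'⟩ :=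
    exists_of_polyFlat_lt (show polyFlat T' < polyFlat T' + ε / 2 by linarith)
  have heq : T + T' = (R + R') + polyBoundary d m (S + S') := by rw [h, h', map_add]; abel
  have h1 := polyFlat_le (R + R') (S + S')
  rw [← heq] at h1
  linarith [polyMass_add_le R R', polyMass_add_le S S']

theorem polyFlat_smul_le (a : ℝ) (T : PolyChain d m) : polyFlat (a • T) ≤ |a| * polyFlat T := by
  refine le_of_forall_pos_lt_add fun ε hε => ?_
  have hpos : 0 < |a| + 1 := by positivity
  obtain ⟨R, S, h, hlt⟩ := exists_of_polyFlat_lt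
    (show polyFlat T < polyFlat T + ε / (|a| + 1) by linarith [div_pos hε hpos])
  have h1 := polyFlat_le (a • R) (a • S)
  rw [map_smul, ← smul_add, ← h] at h1
  have h2 : |a| * (ε / (|a| + 1)) < ε := by
    rw [mul_div_assoc', div_lt_iff₀ hpos]; nlinarith
  nlinarith [abs_nonneg a, polyMass_smul_le a R, polyMass_smul_le a S]

theorem polyFlat_neg (T : PolyChain d m) : polyFlat (-T) = polyFlat T := by
  have h : ∀ T : PolyChain d m, polyFlat (-T) ≤ polyFlat T := fun T => by
    simpa using polyFlat_smul_le (-1) T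
  exact le_antisymm (h T) (by simpa using h (-T))

/-- Polyhedral chains are normed by the flat norm. -/
instance : SeminormedAddCommGroup (PolyChain d m) :=
  AddGroupSeminorm.toSeminormedAddCommGroup
    { toFun := polyFlat
      map_zero' := polyFlat_zero
      add_le' := polyFlat_add_le
      neg' := polyFlat_neg }

theorem norm_polyChain (T : PolyChain d m) : ‖T‖ = polyFlat T := rfl

instance : NormedSpace ℝ (PolyChain d m) where
  norm_smul_le a T := polyFlat_smul_le a T

/-- The space `𝐅ₘ([0, 1]^d)` of flat `m`-chains, the completion of the polyhedral chains for the
flat norm. Its norm is the flat norm `𝐅`. -/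
abbrev FlatChain (d m : ℕ) : Type := UniformSpace.Completion (PolyChain d m)

/-- The space `𝐅^m([0, 1]^d)` of flat `m`-cochains, with the dual norm. -/
abbrev FlatCochain (d m : ℕ) : Type := FlatChain d m →L[ℝ] ℝ

/-- The boundary operator on polyhedral chains, as a continuous map. -/
def polyBoundaryL (d m : ℕ) : PolyChain d (m + 1) →L[ℝ] PolyChain d m :=
  (polyBoundary d m).mkContinuous 1 fun T => by
    rw [one_mul]; exact polyFlat_boundary_le T

/-- The boundary operator on flat chains, the continuous extension of the boundary operator on
polyhedral chains. -/
def flatBoundary (d m : ℕ) : FlatChain d (m + 1) →L[ℝ] FlatChain d m :=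
  ((UniformSpace.Completion.toComplL : PolyChain d m →L[ℝ] FlatChain d m) ∘L
    polyBoundaryL d m).extend UniformSpace.Completion.toComplL

theorem flatBoundary_coe (T : PolyChain d (m + 1)) :
    flatBoundary d m (T : FlatChain d (m + 1)) = ((polyBoundary d m T : PolyChain d m) :) :=
  ContinuousLinearMap.extend_eq (e := (UniformSpace.Completion.toComplL :
    PolyChain d (m + 1) →L[ℝ] FlatChain d (m + 1))) _
    UniformSpace.Completion.denseRange_coe (UniformSpace.Completion.isUniformInducing_coe _) T

/-- The mass of a flat chain, in `[0, ∞]`, defined by relaxation: the infimum of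
`liminf 𝐌(Tₙ)` over the sequences of polyhedral chains `Tₙ` that converge to `T` in flat norm. -/
def flatMass (T : FlatChain d m) : ℝ≥0∞ :=
  ⨅ (u : ℕ → PolyChain d m) (_ : Tendsto (fun n => (u n : FlatChain d m)) atTop (𝓝 T)),
    liminf (fun n => ENNReal.ofReal (polyMass (u n))) atTop

theorem flatMass_le {T : FlatChain d m} {u : ℕ → PolyChain d m} {r : ℝ≥0∞}
    (hu : Tendsto (fun n => (u n : FlatChain d m)) atTop (𝓝 T))
    (h : ∀ n, ENNReal.ofReal (polyMass (u n)) ≤ r) : flatMass T ≤ r := by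
  refine (iInf₂_le u hu).trans ?_
  exact (liminf_le_liminf (Eventually.of_forall h)).trans_eq (by simp)

theorem exists_seq_of_flatMass_lt {T : FlatChain d m} {r : ℝ≥0∞} (h : flatMass T < r) :
    ∃ u : ℕ → PolyChain d m, Tendsto (fun n => (u n : FlatChain d m)) atTop (𝓝 T) ∧
      ∀ n, ENNReal.ofReal (polyMass (u n)) < r := by
  simp only [flatMass, iInf_lt_iff] at h
  obtain ⟨u, hu, hlt⟩ := h
  obtain ⟨φ, hφ, hφr⟩ := extraction_of_frequently_atTop (frequently_lt_of_liminf_lt (by isBoundedDefault) hlt)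
  exact ⟨u ∘ φ, hu.comp hφ.tendsto_atTop, hφr⟩

theorem flatMass_zero : flatMass (0 : FlatChain d m) = 0 := by
  refine le_antisymm (flatMass_le (u := fun _ => 0) ?_ fun n => ?_) zero_le
  · rw [UniformSpace.Completion.coe_zero]
    exact tendsto_const_nhds
  · simp [polyMass_zero]

theorem flatMass_add_le (T T' : FlatChain d m) : flatMass (T + T') ≤ flatMass T + flatMass T' := by
  refine ENNReal.le_of_forall_pos_le_add fun ε hε hfin => ?_
  have hT : flatMass T ≠ ∞ := (lt_of_le_of_lt le_self_add hfin).ne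
  have hT' : flatMass T' ≠ ∞ := (lt_of_le_of_lt le_add_self hfin).ne
  have hε' : (ε / 2 : ℝ≥0∞) ≠ 0 := by simp [hε.ne']
  obtain ⟨u, hu, hlt⟩ := exists_seq_of_flatMass_lt (ENNReal.lt_add_right hT hε')
  obtain ⟨v, hv, hlt'⟩ := exists_seq_of_flatMass_lt (ENNReal.lt_add_right hT' hε')
  refine flatMass_le (u := fun n => u n + v n) ?_ fun n => ?_
  · simpa only [UniformSpace.Completion.coe_add] using hu.add hv
  · calc ENNReal.ofReal (polyMass (u n + v n))
        ≤ ENNReal.ofReal (polyMass (u n)) + ENNReal.ofReal (polyMass (v n)) := by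
          rw [← ENNReal.ofReal_add (polyMass_nonneg _) (polyMass_nonneg _)]
          exact ENNReal.ofReal_le_ofReal (polyMass_add_le _ _)
      _ ≤ (flatMass T + ε / 2) + (flatMass T' + ε / 2) := add_le_add (hlt n).le (hlt' n).le
      _ = flatMass T + flatMass T' + ε := by
          rw [add_add_add_comm, ENNReal.add_halves]

theorem flatMass_smul_lt_top (a : ℝ) {T : FlatChain d m} (h : flatMass T < ∞) :
    flatMass (a • T) < ∞ := by
  obtain ⟨r, hr, hr'⟩ := ENNReal.lt_iff_exists_nnreal_btwn.1 h
  obtain ⟨u, hu, hlt⟩ := exists_seq_of_flatMass_lt hr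
  refine lt_of_le_of_lt (flatMass_le (u := fun n => a • u n) (r := ENNReal.ofReal |a| * r)
    ?_ fun n => ?_) (ENNReal.mul_lt_top ENNReal.ofReal_lt_top hr')
  · simpa only [UniformSpace.Completion.coe_smul] using hu.const_smul a
  · refine (ENNReal.ofReal_le_ofReal (polyMass_smul_le a (u n))).trans ?_
    rw [ENNReal.ofReal_mul (abs_nonneg a)]
    gcongr
    exact (hlt n).le

/-- The mass of the boundary of a flat `m`-chain. The boundary of a `0`-chain is zero. -/
def boundaryMass : {m : ℕ} → FlatChain d m → ℝ≥0∞
  | 0, _ => 0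
  | m + 1, T => flatMass (flatBoundary d m T)

/-- The normal mass `𝐍(T) = 𝐌(T) + 𝐌(∂T)`. -/
def normalMass (T : FlatChain d m) : ℝ≥0∞ := flatMass T + boundaryMass T

theorem boundaryMass_zero : boundaryMass (0 : FlatChain d m) = 0 := by
  cases m with
  | zero => rfl
  | succ m => simp [boundaryMass, flatMass_zero]

theorem boundaryMass_add_le (T T' : FlatChain d m) :
    boundaryMass (T + T') ≤ boundaryMass T + boundaryMass T' := by
  cases m with
  | zero => simp [boundaryMass]
  | succ m => simpa [boundaryMass] using flatMass_add_le _ _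

theorem boundaryMass_smul_lt_top (a : ℝ) {T : FlatChain d m} (h : boundaryMass T < ∞) :
    boundaryMass (a • T) < ∞ := by
  cases m with
  | zero => simp [boundaryMass]
  | succ m => simpa [boundaryMass] using flatMass_smul_lt_top a h

/-- The space `𝐍ₘ([0, 1]^d)` of normal `m`-currents. -/
def NormalCurrent (d m : ℕ) : Submodule ℝ (FlatChain d m) where
  carrier := {T | normalMass T < ∞}
  zero_mem' := by simp [normalMass, flatMass_zero, boundaryMass_zero]
  add_mem' {T T'} hT hT' := by
    simp only [normalMass, Set.mem_ofPred_eq, ENNReal.add_lt_top] at *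
    exact ⟨(flatMass_add_le T T').trans_lt (ENNReal.add_lt_top.2 ⟨hT.1, hT'.1⟩),
      (boundaryMass_add_le T T').trans_lt (ENNReal.add_lt_top.2 ⟨hT.2, hT'.2⟩)⟩
  smul_mem' a T hT := by
    simp only [normalMass, Set.mem_ofPred_eq, ENNReal.add_lt_top] at *
    exact ⟨flatMass_smul_lt_top a hT.1, boundaryMass_smul_lt_top a hT.2⟩

/-- The normal mass of a normal current, as a real number. -/
def nMass (T : NormalCurrent d m) : ℝ := (normalMass (T : FlatChain d m)).toReal

/-- The flat norm of a normal current. -/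
def fNorm (T : NormalCurrent d m) : ℝ := ‖(T : FlatChain d m)‖

/-- An `m`-charge is a linear functional on normal currents such that `ω(Tₙ) → 0` for all sequences
`Tₙ` that converge to `0` in flat norm and have bounded normal masses. -/
def IsCharge (ω : NormalCurrent d m →ₗ[ℝ] ℝ) : Prop :=
  ∀ T : ℕ → NormalCurrent d m, Tendsto (fun n => fNorm (T n)) atTop (𝓝 0) →
    (∃ B : ℝ, ∀ n, nMass (T n) ≤ B) → Tendsto (fun n => ω (T n)) atTop (𝓝 0)

/-- The norm `‖ω‖_{𝐂𝐇^m} = sup {|ω(T)| : 𝐍(T) ≤ 1}`, with values in `[0, ∞]` for arbitrary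
linear functionals. -/
def chargeNorm (ω : NormalCurrent d m →ₗ[ℝ] ℝ) : ℝ≥0∞ :=
  ⨆ (T : NormalCurrent d m) (_ : nMass T ≤ 1), ENNReal.ofReal |ω T|

/-- `C` is an admissible constant in the definition of fractional charges. -/
def FractionalBound (γ C : ℝ) (ω : NormalCurrent d m →ₗ[ℝ] ℝ) : Prop :=
  0 ≤ C ∧ ∀ T : NormalCurrent d m, |ω T| ≤ C * (nMass T ^ (1 - γ) * fNorm T ^ γ)

/-- A `γ`-fractional `m`-charge is a linear functional on normal currents with
`|ω(T)| ≤ C 𝐍(T)^(1-γ) 𝐅(T)^γ` for some constant `C`. -/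
def IsFractionalCharge (γ : ℝ) (ω : NormalCurrent d m →ₗ[ℝ] ℝ) : Prop :=
  ∃ C, FractionalBound γ C ω

/-- The norm `‖ω‖_{𝐂𝐇^{m,γ}}` of a `γ`-fractional charge: the best admissible constant. -/
def fractionalNorm (γ : ℝ) (ω : NormalCurrent d m →ₗ[ℝ] ℝ) : ℝ :=
  sInf {C | FractionalBound γ C ω}

/-- Weak* convergence in `𝐂𝐇^{m,γ}([0, 1]^d)` of a sequence of `γ`-fractional charges to a
`γ`-fractional charge: the sequence is bounded in `𝐂𝐇^{m,γ}` and converges in `𝐂𝐇^m`. -/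
structure WeakStarTendsto (γ : ℝ) (ω : ℕ → NormalCurrent d m →ₗ[ℝ] ℝ)
    (Ω : NormalCurrent d m →ₗ[ℝ] ℝ) : Prop where
  isFractional : ∀ n, IsFractionalCharge γ (ω n)
  isFractional_limit : IsFractionalCharge γ Ω
  bounded : ∃ B : ℝ, ∀ n, fractionalNorm γ (ω n) ≤ B
  isCharge : ∀ n, IsCharge (ω n)
  isCharge_limit : IsCharge Ω
  tendsto : Tendsto (fun n => chargeNorm (ω n - Ω)) atTop (𝓝 0)

/-- The restriction of a flat cochain to normal currents. -/
def FlatCochain.toCharge (ω : FlatCochain d m) : NormalCurrent d m →ₗ[ℝ] ℝ :=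
  (ω : FlatChain d m →ₗ[ℝ] ℝ).domRestrict (NormalCurrent d m)

end FlatChains

end

/-! Fix a normal current `T`. The two hypotheses bound `|ω n T|` by `κ 2^(n(1-γ)) 𝐅(T)`, which grows
with `n`, and by `κ 2^(-nγ) 𝐍(T)`, which decays. The bounds coincide at the scale `2^n = 𝐍(T)/𝐅(T)`,
where both equal `κ 𝐍(T)^(1-γ) 𝐅(T)^γ`. Using the flat bound below that scale and the charge bound
above it leaves two geometric sums, each controlled by its largest term, hence by the crossover
value times a constant depending on `γ` alone. This is `sum_le_interpolation`.

The estimate holds for the sum of absolute values and is uniform in the number of terms, so it gives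
the fractional bound both for the partial sums and for their pointwise limit (`fractionalBound_sum`,
`fractionalBound_pointwiseTsum`). Convergence in `𝐂𝐇^m` needs only the decaying bound: the tails are
dominated by a geometric tail, uniformly on `𝐍(T) ≤ 1` (`chargeNorm_sum_sub_pointwiseTsum_le`). The
geometry of flat chains enters only through the homogeneity of the mass, which turns the charge norm
into a pointwise estimate. -/

/-! ### Interpolation between two geometric bounds -/

/-- A sum whose terms are dominated by an increasing and by a decreasing geometric sequence is
controlled by the interpolated quantity. -/
theorem sum_le_interpolation {γ : ℝ} (hγ₀ : 0 < γ) (hγ₁ : γ < 1) {F N : ℝ} (hF : 0 ≤ F)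
    (hN : 0 ≤ N) {a : ℕ → ℝ} (h₁ : ∀ n : ℕ, a n ≤ ((2 : ℝ) ^ (1 - γ)) ^ n * F)
    (h₂ : ∀ n : ℕ, a n ≤ ((2 : ℝ) ^ (-γ)) ^ n * N) (M : ℕ) :
    ∑ n ∈ Finset.range M, a n ≤
      ((2 : ℝ) ^ (1 - γ) / ((2 : ℝ) ^ (1 - γ) - 1) + 1 / (1 - (2 : ℝ) ^ (-γ))) *
        (N ^ (1 - γ) * F ^ γ) := by
  have hγ' : 0 < 1 - γ := by linarith
  have hp₁ : (2 : ℝ) ^ (-γ) < 1 := Real.rpow_lt_one_of_one_lt_of_neg (by norm_num) (by linarith)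
  have hq₁ : 1 < (2 : ℝ) ^ (1 - γ) := Real.one_lt_rpow (by norm_num) hγ'
  -- If `F` or `N` vanishes, the crossover scale `N / F` is useless, but one of the bounds makes
  -- every term nonpositive and the right side is zero because both exponents are positive.
  rcases hF.eq_or_lt with rfl | hF
  · rw [Real.zero_rpow hγ₀.ne', mul_zero, mul_zero]
    exact Finset.sum_nonpos fun n _ => by simpa using h₁ n
  rcases hN.eq_or_lt with rfl | hN
  · rw [Real.zero_rpow hγ'.ne', zero_mul, mul_zero]
    exact Finset.sum_nonpos fun n _ => by simpa using h₂ n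
  have hx : 0 < N / F := div_pos hN hF
  -- At the crossover `2 ^ n = N / F` the two bounds take the same value; `eF` and `eN` compute it
  -- from each side.
  have eF : F * (N / F) ^ (1 - γ) = N ^ (1 - γ) * F ^ γ := by
    rw [Real.div_rpow hN.le hF.le, Real.rpow_sub hF, Real.rpow_one]
    have := (Real.rpow_pos_of_pos hF γ).ne'
    field_simp
  have eN : N * (N / F) ^ (-γ) = N ^ (1 - γ) * F ^ γ := by
    rw [Real.div_rpow hN.le hF.le, Real.rpow_sub hN, Real.rpow_one, Real.rpow_neg hN.le,
      Real.rpow_neg hF.le]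
    have := (Real.rpow_pos_of_pos hF γ).ne'
    have := (Real.rpow_pos_of_pos hN γ).ne'
    field_simp
  have hpow : ∀ (s : ℝ) (n : ℕ), ((2 : ℝ) ^ s) ^ n = ((2 : ℝ) ^ n) ^ s := fun s n => by
    rw [← Real.rpow_natCast, ← Real.rpow_natCast, ← Real.rpow_mul (by norm_num),
      ← Real.rpow_mul (by norm_num), mul_comm]
  set p := (2 : ℝ) ^ (-γ) with hp
  set q := (2 : ℝ) ^ (1 - γ) with hq
  have hp₀ : 0 < p := by positivity
  have hq₀ : 0 < q := by positivity
  -- The index `k` rounds the crossover up to a power of two. Rounding up is harmless for the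
  -- decaying bound and costs one factor `q` for the growing one. If `N / F ≤ 1`, the decaying bound
  -- serves from the start: `k = 0`, and the first block is empty, so no bound on `q ^ k` is needed.
  obtain ⟨k, hk, hk'⟩ : ∃ k : ℕ, N / F ≤ 2 ^ k ∧ (k = 0 ∨ q ^ k ≤ q * (N / F) ^ (1 - γ)) := by
    rcases le_total (N / F) 1 with h | h
    · exact ⟨0, by simpa using h, Or.inl rfl⟩
    · obtain ⟨n, hn, hn'⟩ := exists_nat_pow_near h (one_lt_two : (1 : ℝ) < 2)
      refine ⟨n + 1, hn'.le, Or.inr ?_⟩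
      rw [pow_succ', hq, hpow]
      gcongr
  have hfirst : ∑ n ∈ Finset.range k, q ^ n * F ≤ q / (q - 1) * (N ^ (1 - γ) * F ^ γ) := by
    rcases hk' with rfl | hk'
    · have := sub_pos.2 hq₁
      simp only [Finset.range_zero, Finset.sum_empty]
      positivity
    · rw [← Finset.sum_mul, geom_sum_eq hq₁.ne', ← eF, div_mul_eq_mul_div, div_mul_eq_mul_div]
      refine div_le_div_of_nonneg_right ?_ (sub_pos.2 hq₁).le
      rw [mul_left_comm, mul_comm]
      exact mul_le_mul_of_nonneg_left (by linarith) hF.le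
  have hsecond : ∑ n ∈ Finset.range M, p ^ (k + n) * N ≤ 1 / (1 - p) * (N ^ (1 - γ) * F ^ γ) := by
    have hgeom : ∑ n ∈ Finset.range M, p ^ n ≤ 1 / (1 - p) := by
      have := (summable_geometric_of_lt_one hp₀.le hp₁).sum_le_tsum (Finset.range M)
        (fun _ _ => by positivity)
      rwa [tsum_geometric_of_lt_one hp₀.le hp₁, ← one_div] at this
    have hpk : p ^ k ≤ (N / F) ^ (-γ) := by
      rw [hp, hpow]
      exact Real.rpow_le_rpow_of_nonpos hx hk (by linarith)
    calc ∑ n ∈ Finset.range M, p ^ (k + n) * N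
        = (∑ n ∈ Finset.range M, p ^ n) * (N * p ^ k) := by
          rw [Finset.sum_mul]
          exact Finset.sum_congr rfl fun n _ => by rw [pow_add]; ring
      _ ≤ 1 / (1 - p) * (N * (N / F) ^ (-γ)) := by
          have := sub_pos.2 hp₁
          gcongr
      _ = _ := by rw [eN]
  -- The terms may be negative; passing to positive parts allows the range to be enlarged to `k +
  -- M`, which avoids comparing `k` with `M` before splitting at `k`.
  calc ∑ n ∈ Finset.range M, a n
      ≤ ∑ n ∈ Finset.range M, max (a n) 0 := Finset.sum_le_sum fun _ _ => le_max_left _ _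
    _ ≤ ∑ n ∈ Finset.range (k + M), max (a n) 0 :=
        Finset.sum_le_sum_of_subset_of_nonneg (Finset.range_mono (by omega))
          fun _ _ _ => le_max_right _ _
    _ = ∑ n ∈ Finset.range k, max (a n) 0 + ∑ n ∈ Finset.range M, max (a (k + n)) 0 :=
        Finset.sum_range_add _ _ _
    _ ≤ ∑ n ∈ Finset.range k, q ^ n * F + ∑ n ∈ Finset.range M, p ^ (k + n) * N :=
        add_le_add (Finset.sum_le_sum fun n _ => max_le (h₁ n) (by positivity))
          (Finset.sum_le_sum fun n _ => max_le (h₂ _) (by positivity))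
    _ ≤ _ := by rw [add_mul]; exact add_le_add hfirst hsecond

/-! ### Homogeneity of the masses and pointwise estimates -/

namespace FlatChains

variable {d m : ℕ}

/-- Multiplying an approximating sequence by `a` multiplies its masses by at most `|a|`. Dividing by
`|a|`, legitimate since `a ≠ 0`, reduces the claim to real test values above `flatMass T`, so that
infinite mass needs no separate case. -/
theorem flatMass_smul_le {a : ℝ} (ha : a ≠ 0) (T : FlatChain d m) :
    flatMass (a • T) ≤ ENNReal.ofReal |a| * flatMass T := by
  have ha₀ : ENNReal.ofReal |a| ≠ 0 := by simpa using ha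
  rw [mul_comm, ← ENNReal.div_le_iff ha₀ ENNReal.ofReal_ne_top]
  refine le_of_forall_gt_imp_ge_of_dense fun r hr => ?_
  rw [ENNReal.div_le_iff ha₀ ENNReal.ofReal_ne_top]
  obtain ⟨u, hu, hlt⟩ := exists_seq_of_flatMass_lt hr
  refine flatMass_le (u := fun n => a • u n) ?_ fun n => ?_
  · simpa only [UniformSpace.Completion.coe_smul] using hu.const_smul a
  · refine (ENNReal.ofReal_le_ofReal (polyMass_smul_le a (u n))).trans ?_
    rw [ENNReal.ofReal_mul (abs_nonneg a), mul_comm]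
    gcongr
    exact (hlt n).le

theorem boundaryMass_smul_le {a : ℝ} (ha : a ≠ 0) (T : FlatChain d m) :
    boundaryMass (a • T) ≤ ENNReal.ofReal |a| * boundaryMass T := by
  cases m with
  | zero => simp [boundaryMass]
  | succ m => simpa [boundaryMass] using flatMass_smul_le ha _

theorem nMass_nonneg (T : NormalCurrent d m) : 0 ≤ nMass T := ENNReal.toReal_nonneg

theorem fNorm_nonneg (T : NormalCurrent d m) : 0 ≤ fNorm T := norm_nonneg _

theorem nMass_smul_le {a : ℝ} (ha : a ≠ 0) (T : NormalCurrent d m) :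
    nMass (a • T) ≤ |a| * nMass T := by
  have hT : normalMass (T : FlatChain d m) ≠ ∞ := ne_of_lt T.2
  have h : normalMass (a • (T : FlatChain d m)) ≤ ENNReal.ofReal |a| * normalMass (T : FlatChain d m) := by
    rw [normalMass, normalMass, mul_add]
    exact add_le_add (flatMass_smul_le ha _) (boundaryMass_smul_le ha _)
  have := ENNReal.toReal_mono (ENNReal.mul_ne_top ENNReal.ofReal_ne_top hT) h
  rwa [ENNReal.toReal_mul, ENNReal.toReal_ofReal (abs_nonneg a)] at this

/-- Rescaling to the unit ball of the normal mass. This is how the decay of the charge norms is used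
on individual currents. -/
theorem abs_apply_le_of_chargeNorm_le {ω : NormalCurrent d m →ₗ[ℝ] ℝ} {K : ℝ} (hK : 0 ≤ K)
    (h : chargeNorm ω ≤ ENNReal.ofReal K) (T : NormalCurrent d m) : |ω T| ≤ K * nMass T := by
  have hN := nMass_nonneg T
  refine le_of_forall_pos_le_add fun ε hε => ?_
  -- Dividing by slightly more than `nMass T` covers the case `nMass T = 0` without showing that `T`
  -- vanishes. The error is then `K * (ε / (K + 1)) ≤ ε`, also when `K = 0`.
  set r := nMass T + ε / (K + 1) with hr
  have hr₀ : 0 < r := by positivity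
  have h1 : nMass (r⁻¹ • T) ≤ 1 := by
    refine (nMass_smul_le (inv_ne_zero hr₀.ne') T).trans ?_
    rw [abs_of_pos (inv_pos.2 hr₀), inv_mul_le_iff₀ hr₀, mul_one, hr]
    exact le_add_of_nonneg_right (by positivity)
  have h2 : ENNReal.ofReal |ω (r⁻¹ • T)| ≤ ENNReal.ofReal K :=
    (le_iSup₂ (f := fun (S : NormalCurrent d m) (_ : nMass S ≤ 1) => ENNReal.ofReal |ω S|)
      (r⁻¹ • T) h1).trans h
  rw [ENNReal.ofReal_le_ofReal_iff hK, map_smul, smul_eq_mul, abs_mul,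
    abs_of_pos (inv_pos.2 hr₀), inv_mul_le_iff₀ hr₀] at h2
  have h3 : K * (ε / (K + 1)) ≤ ε := by
    rw [mul_div_assoc', div_le_iff₀ (by positivity)]
    nlinarith
  rw [hr] at h2
  linarith

theorem FlatCochain.abs_toCharge_le (ω : FlatCochain d m) (T : NormalCurrent d m) :
    |ω.toCharge T| ≤ ‖ω‖ * fNorm T :=
  ω.le_opNorm (T : FlatChain d m)

/-- Along a sequence of bounded normal mass the factor `nMass ^ (1 - γ)` stays bounded, while `fNorm
^ γ` tends to zero because `γ > 0`. -/
theorem FractionalBound.isCharge {γ C : ℝ} (hγ₀ : 0 < γ) (hγ₁ : γ < 1)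
    {ω : NormalCurrent d m →ₗ[ℝ] ℝ} (h : FractionalBound γ C ω) : IsCharge ω := by
  rintro T hT ⟨B, hB⟩
  refine squeeze_zero_norm (a := fun n => C * (B ^ (1 - γ) * fNorm (T n) ^ γ))
    (fun n => (h.2 (T n)).trans ?_) ?_
  · have := nMass_nonneg (T n)
    have := fNorm_nonneg (T n)
    have := h.1
    have := hB n
    gcongr
  · have := hT.rpow_const (p := γ) (Or.inr hγ₀.le)
    rw [Real.zero_rpow hγ₀.ne'] at this
    simpa using (this.const_mul (B ^ (1 - γ))).const_mul C

theorem FractionalBound.fractionalNorm_le {γ C : ℝ} {ω : NormalCurrent d m →ₗ[ℝ] ℝ}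
    (h : FractionalBound γ C ω) : fractionalNorm γ ω ≤ C :=
  csInf_le ⟨0, fun _ h' => h'.1⟩ h

/-! ### The limit functional and the constant -/

/-- The pointwise sum of a pointwise summable sequence of linear functionals. -/
noncomputable def pointwiseTsum (ω : ℕ → NormalCurrent d m →ₗ[ℝ] ℝ) (h : ∀ T, Summable fun n => ω n T) :
    NormalCurrent d m →ₗ[ℝ] ℝ where
  toFun T := ∑' n, ω n T
  map_add' S T := by
    simp only [map_add]
    exact (h S).tsum_add (h T)
  map_smul' a T := by
    simp only [map_smul, smul_eq_mul, RingHom.id_apply]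
    exact tsum_mul_left

theorem pointwiseTsum_apply (ω : ℕ → NormalCurrent d m →ₗ[ℝ] ℝ)
    (h : ∀ T, Summable fun n => ω n T) (T : NormalCurrent d m) :
    pointwiseTsum ω h T = ∑' n, ω n T :=
  rfl

/-- The constant of `sum_le_interpolation`. -/
noncomputable def interpolationConst (γ : ℝ) : ℝ :=
  (2 : ℝ) ^ (1 - γ) / ((2 : ℝ) ^ (1 - γ) - 1) + 1 / (1 - (2 : ℝ) ^ (-γ))

theorem two_rpow_neg_lt_one {γ : ℝ} (hγ₀ : 0 < γ) : (2 : ℝ) ^ (-γ) < 1 :=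
  Real.rpow_lt_one_of_one_lt_of_neg (by norm_num) (by linarith)

theorem interpolationConst_nonneg {γ : ℝ} (hγ₀ : 0 < γ) (hγ₁ : γ < 1) :
    0 ≤ interpolationConst γ := by
  have := sub_pos.2 (Real.one_lt_rpow (one_lt_two : (1 : ℝ) < 2) (sub_pos.2 hγ₁))
  have := sub_pos.2 (two_rpow_neg_lt_one hγ₀)
  unfold interpolationConst
  positivity

/-! ### Series of functionals with a growing flat bound and a decaying normal bound -/

section Series

variable {γ κ : ℝ} {ω : ℕ → NormalCurrent d m →ₗ[ℝ] ℝ}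

theorem summable_abs_apply (hγ₀ : 0 < γ)
    (hN : ∀ n T, |ω n T| ≤ ((2 : ℝ) ^ (-γ)) ^ n * (κ * nMass T)) (T : NormalCurrent d m) :
    Summable fun n => |ω n T| :=
  .of_nonneg_of_le (fun _ => abs_nonneg _) (fun n => hN n T)
    ((summable_geometric_of_lt_one (by positivity) (two_rpow_neg_lt_one hγ₀)).mul_right _)

theorem sum_abs_apply_le (hγ₀ : 0 < γ) (hγ₁ : γ < 1) (hκ : 0 ≤ κ)
    (hF : ∀ n T, |ω n T| ≤ ((2 : ℝ) ^ (1 - γ)) ^ n * (κ * fNorm T))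
    (hN : ∀ n T, |ω n T| ≤ ((2 : ℝ) ^ (-γ)) ^ n * (κ * nMass T)) (M : ℕ)
    (T : NormalCurrent d m) :
    ∑ n ∈ Finset.range M, |ω n T| ≤
      interpolationConst γ * κ * (nMass T ^ (1 - γ) * fNorm T ^ γ) := by
  have hT := fNorm_nonneg T
  have hT' := nMass_nonneg T
  refine (sum_le_interpolation hγ₀ hγ₁ (mul_nonneg hκ hT) (mul_nonneg hκ hT') (fun n => hF n T)
    (fun n => hN n T) M).trans_eq ?_
  -- The interpolation is applied to `κ * fNorm T` and `κ * nMass T`; since the exponents add up to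
  -- one, `κ` comes out linearly.
  have hκγ : κ ^ (1 - γ) * κ ^ γ = κ := by
    rw [← Real.rpow_add_of_nonneg hκ (by linarith) hγ₀.le, sub_add_cancel, Real.rpow_one]
  rw [Real.mul_rpow hκ hT', Real.mul_rpow hκ hT, ← interpolationConst]
  linear_combination (interpolationConst γ * (nMass T ^ (1 - γ) * fNorm T ^ γ)) * hκγ

theorem fractionalBound_sum (hγ₀ : 0 < γ) (hγ₁ : γ < 1) (hκ : 0 ≤ κ)
    (hF : ∀ n T, |ω n T| ≤ ((2 : ℝ) ^ (1 - γ)) ^ n * (κ * fNorm T))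
    (hN : ∀ n T, |ω n T| ≤ ((2 : ℝ) ^ (-γ)) ^ n * (κ * nMass T)) (M : ℕ) :
    FractionalBound γ (interpolationConst γ * κ) (∑ n ∈ Finset.range M, ω n) := by
  refine ⟨mul_nonneg (interpolationConst_nonneg hγ₀ hγ₁) hκ, fun T => ?_⟩
  rw [LinearMap.sum_apply]
  exact (Finset.abs_sum_le_sum_abs _ _).trans (sum_abs_apply_le hγ₀ hγ₁ hκ hF hN M T)

/-- The bound on the sums of absolute values does not depend on the number of terms, so it passes to
the infinite sum with the same constant. -/
theorem fractionalBound_pointwiseTsum (hγ₀ : 0 < γ) (hγ₁ : γ < 1) (hκ : 0 ≤ κ)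
    (hF : ∀ n T, |ω n T| ≤ ((2 : ℝ) ^ (1 - γ)) ^ n * (κ * fNorm T))
    (hN : ∀ n T, |ω n T| ≤ ((2 : ℝ) ^ (-γ)) ^ n * (κ * nMass T))
    (h : ∀ T, Summable fun n => ω n T) :
    FractionalBound γ (interpolationConst γ * κ) (pointwiseTsum ω h) := by
  refine ⟨mul_nonneg (interpolationConst_nonneg hγ₀ hγ₁) hκ, fun T => ?_⟩
  have h₁ : ‖∑' n, ω n T‖ ≤ ∑' n, ‖ω n T‖ :=
    norm_tsum_le_tsum_norm (summable_abs_apply hγ₀ hN T)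
  simp only [Real.norm_eq_abs] at h₁
  rw [pointwiseTsum_apply]
  exact h₁.trans <| Real.tsum_le_of_sum_range_le (fun _ => abs_nonneg _) fun M =>
    sum_abs_apply_le hγ₀ hγ₁ hκ hF hN M T

/-- The difference is minus the tail of the series, and on `nMass T ≤ 1` the tail is dominated by a
geometric series independent of `T`. -/
theorem chargeNorm_sum_sub_pointwiseTsum_le (hγ₀ : 0 < γ) (hκ : 0 ≤ κ)
    (hN : ∀ n T, |ω n T| ≤ ((2 : ℝ) ^ (-γ)) ^ n * (κ * nMass T))
    (h : ∀ T, Summable fun n => ω n T) (M : ℕ) :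
    chargeNorm (∑ n ∈ Finset.range M, ω n - pointwiseTsum ω h) ≤
      ENNReal.ofReal (((2 : ℝ) ^ (-γ)) ^ M * ((1 - (2 : ℝ) ^ (-γ))⁻¹ * κ)) := by
  refine iSup₂_le fun T hT => ENNReal.ofReal_le_ofReal ?_
  have hdiff : (∑ n ∈ Finset.range M, ω n - pointwiseTsum ω h) T = - ∑' n, ω (n + M) T := by
    have := (h T).sum_add_tsum_nat_add M
    rw [LinearMap.sub_apply, LinearMap.sum_apply, pointwiseTsum_apply]
    linarith
  rw [hdiff, abs_neg]
  refine tsum_of_norm_bounded (f := fun n => ω (n + M) T)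
    (((hasSum_geometric_of_lt_one (by positivity) (two_rpow_neg_lt_one hγ₀)).mul_right κ).mul_left
      _) fun n => ?_
  refine (hN (n + M) T).trans ?_
  rw [pow_add, mul_comm (_ ^ n), mul_assoc]
  gcongr
  exact mul_le_of_le_one_right hκ hT

/-- Boundedness comes from the constant `interpolationConst γ * κ` common to all partial sums, the
charge property from the fractional bounds, and convergence from the geometric tail. -/
theorem weakStarTendsto_pointwiseTsum (hγ₀ : 0 < γ) (hγ₁ : γ < 1) (hκ : 0 ≤ κ)
    (hF : ∀ n T, |ω n T| ≤ ((2 : ℝ) ^ (1 - γ)) ^ n * (κ * fNorm T))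
    (hN : ∀ n T, |ω n T| ≤ ((2 : ℝ) ^ (-γ)) ^ n * (κ * nMass T))
    (h : ∀ T, Summable fun n => ω n T) :
    WeakStarTendsto γ (fun M => ∑ n ∈ Finset.range M, ω n) (pointwiseTsum ω h) where
  isFractional M := ⟨_, fractionalBound_sum hγ₀ hγ₁ hκ hF hN M⟩
  isFractional_limit := ⟨_, fractionalBound_pointwiseTsum hγ₀ hγ₁ hκ hF hN h⟩
  bounded := ⟨_, fun M => (fractionalBound_sum hγ₀ hγ₁ hκ hF hN M).fractionalNorm_le⟩
  isCharge M := (fractionalBound_sum hγ₀ hγ₁ hκ hF hN M).isCharge hγ₀ hγ₁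
  isCharge_limit := (fractionalBound_pointwiseTsum hγ₀ hγ₁ hκ hF hN h).isCharge hγ₀ hγ₁
  tendsto := by
    refine tendsto_of_tendsto_of_tendsto_of_le_of_le tendsto_const_nhds ?_ (fun _ => zero_le)
      (chargeNorm_sum_sub_pointwiseTsum_le hγ₀ hκ hN h)
    have := (tendsto_pow_atTop_nhds_zero_of_lt_one (by positivity)
      (two_rpow_neg_lt_one hγ₀)).mul_const ((1 - (2 : ℝ) ^ (-γ))⁻¹ * κ)
    rw [zero_mul] at this
    simpa using ENNReal.tendsto_ofReal this

end Series

/-! ### From the norm hypotheses to pointwise bounds, and conclusion -/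

theorem FlatCochain.abs_toCharge_le_of_norm_le {γ κ : ℝ} {ω : FlatCochain d m} {n : ℕ}
    (h : ‖ω‖ ≤ κ * (2 : ℝ) ^ ((n : ℝ) * (1 - γ))) (T : NormalCurrent d m) :
    |ω.toCharge T| ≤ ((2 : ℝ) ^ (1 - γ)) ^ n * (κ * fNorm T) := by
  refine (ω.abs_toCharge_le T).trans ?_
  rw [← Real.rpow_natCast, ← Real.rpow_mul zero_le_two, mul_comm (1 - γ), ← mul_assoc,
    mul_comm _ κ]
  exact mul_le_mul_of_nonneg_right h (fNorm_nonneg T)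

theorem abs_apply_le_of_chargeNorm_le_div {γ κ : ℝ} (hκ : 0 ≤ κ)
    {ω : NormalCurrent d m →ₗ[ℝ] ℝ} {n : ℕ}
    (h : chargeNorm ω ≤ ENNReal.ofReal (κ / (2 : ℝ) ^ ((n : ℝ) * γ))) (T : NormalCurrent d m) :
    |ω T| ≤ ((2 : ℝ) ^ (-γ)) ^ n * (κ * nMass T) := by
  refine (abs_apply_le_of_chargeNorm_le (by positivity) h T).trans_eq ?_
  rw [← Real.rpow_natCast, ← Real.rpow_mul zero_le_two, neg_mul, mul_comm γ,
    Real.rpow_neg zero_le_two]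
  ring

end FlatChains

theorem mainTheorem9 (γ : ℝ) (hγ₀ : 0 < γ) (hγ₁ : γ < 1) :
    ∃ C : ℝ, ∀ (d m : ℕ) (κ : ℝ) (ω : ℕ → FlatChains.FlatCochain d m), 0 ≤ κ →
      (∀ n : ℕ, ‖ω n‖ ≤ κ * (2 : ℝ) ^ ((n : ℝ) * (1 - γ))) →
      (∀ n : ℕ, FlatChains.chargeNorm (ω n).toCharge ≤
        ENNReal.ofReal (κ / (2 : ℝ) ^ ((n : ℝ) * γ))) →
      ∃ Ω : FlatChains.NormalCurrent d m →ₗ[ℝ] ℝ,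
        FlatChains.WeakStarTendsto γ
          (fun N => ∑ n ∈ Finset.range N, (ω n).toCharge) Ω ∧
        FlatChains.fractionalNorm γ Ω ≤ C * κ := by
  refine ⟨FlatChains.interpolationConst γ, fun d m κ ω hκ hω hω' => ?_⟩
  have hF n T := FlatChains.FlatCochain.abs_toCharge_le_of_norm_le (hω n) T
  have hN n T := FlatChains.abs_apply_le_of_chargeNorm_le_div hκ (hω' n) T
  have h T := (FlatChains.summable_abs_apply hγ₀ hN T).of_abs
  exact ⟨FlatChains.pointwiseTsum _ h,
    FlatChains.weakStarTendsto_pointwiseTsum hγ₀ hγ₁ hκ hF hN h,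
    (FlatChains.fractionalBound_pointwiseTsum hγ₀ hγ₁ hκ hF hN h).fractionalNorm_le⟩
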